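/- Let $\mathcal H$ be a complex Hilbert space, let $\mathcal B(\mathcal H)$ be the algebra of bounded linear operators on $\mathcal H$, let $d,m,n\ge 0$ and $q\ge 1$ be integers, and write $|\gamma|=\gamma_1+\dots+\gamma_d$, $\gamma!=\gamma_1!\cdots\gamma_d!$ for $\gamma\in\mathbb N_0^d$. For a $d$-tuple $\mathbf R=(R_1,\dots,R_d)$ of pairwise commuting bounded operators on a Hilbert space put $\mathbf R^\gamma=R_1^{\gamma_1}\cdots R_d^{\gamma_d}$, $\mathbf R^{*\gamma}=(R_1^*)^{\gamma_1}\cdots (R_d^*)^{\gamma_d}$, $$\mathbf M_m(\mathbf R)=\sum_{k=0}^m(-1)^{m-k}\binom mk\sum_{|\gamma|=k}\frac{k!}{\gamma!}\,\mathbf R^{*\gamma}\mathbf R^{\gamma},$$ $$\Lambda_{m,n}(\mathbf R)=\sum_{k=0}^n(-1)^{n-k}\binom nk\,(R_1^*+\dots+R_d^*)^k\,\mathbf M_m(\mathbf R)\,(R_1+\dots+R_d)^{n-k}.$$ A $d$-tuple $\mathbf R$ is called $(m,n)$-isosymmetric if its entries commute pairwise and $\Lambda_{m,n}(\mathbf R)=0$.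 A $d$-tuple $\mathbf Q=(Q_1,\dots,Q_d)$ is called $q$-nilpotent if its entries commute pairwise and $\mathbf Q^\alpha=0$ for all $\alpha\in\mathbb N_0^d$ with $|\alpha|=q$. Let $\mathbf R=(R_1,\dots,R_d)\in\mathcal B(\mathcal H)^d$ be $(m,n)$-isosymmetric and let $\mathbf Q=(Q_1,\dots,Q_d)\in\mathcal B(\mathcal H)^d$ be $q$-nilpotent. Then the $d$-tuple $$\mathbf R\otimes\mathbf I+\mathbf I\otimes\mathbf Q:=(R_1\otimes I+I\otimes Q_1,\ \dots,\ R_d\otimes I+I\otimes Q_d)$$ of bounded operators on the Hilbert space tensor product $\mathcal H\overline\otimes\mathcal H$ (the completion of the algebraic tensor product in the inner product determined by $\langle a\otimes b,c\otimes e\rangle=\langle a,c\rangle\langle b,e\rangle$) is $(m+2q-2,\;n+2q-1)$-isosymmetric; in particular its entries commute pairwise. -/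

import Mathlib

open scoped TensorProduct

namespace Multiop

noncomputable section

variable {H : Type*} [NormedAddCommGroup H] [InnerProductSpace ℂ H]

/-- The entries of the tuple commute pairwise. -/
def IsCommuting {d : ℕ} (R : Fin d → H →L[ℂ] H) : Prop :=
  ∀ i j : Fin d, R i * R j = R j * R i

/-- The monomial `R₁ ^ γ₁ * ⋯ * R_d ^ γ_d`, with the factors in this order. -/
def monomial {d : ℕ} (R : Fin d → H →L[ℂ] H) (γ : Fin d → ℕ) : H →L[ℂ] H :=
  (List.ofFn fun i : Fin d => R i ^ γ i).prod

/-- A commuting tuple is `q`-nilpotent if all its monomials of degree `q` vanish. -/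
def IsNilpotentOfOrder {d : ℕ} (q : ℕ) (Q : Fin d → H →L[ℂ] H) : Prop :=
  IsCommuting Q ∧ ∀ α : Fin d → ℕ, ∑ i, α i = q → monomial Q α = 0

variable [CompleteSpace H]

/-- The tuple of adjoints `(R₁*, …, R_d*)`. -/
def adjointTuple {d : ℕ} (R : Fin d → H →L[ℂ] H) : Fin d → H →L[ℂ] H :=
  fun i => ContinuousLinearMap.adjoint (R i)

/-- `M_m(R) = ∑_{k ≤ m} (-1)^(m-k) C(m,k) ∑_{|γ| = k} (k! / γ!) R*^γ R^γ`. -/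
def isometricDefect {d : ℕ} (m : ℕ) (R : Fin d → H →L[ℂ] H) : H →L[ℂ] H :=
  ∑ k ∈ Finset.range (m + 1), ((-1 : ℂ) ^ (m - k) * (m.choose k : ℂ)) •
    ∑ γ ∈ Finset.piAntidiag (Finset.univ : Finset (Fin d)) k,
      (Nat.multinomial Finset.univ γ : ℂ) • (monomial (adjointTuple R) γ * monomial R γ)

/-- `Λ_{m,n}(R) = ∑_{k ≤ n} (-1)^(n-k) C(n,k) (∑ R_i*)^k M_m(R) (∑ R_i)^(n-k)`. -/
def isosymmetricDefect {d : ℕ} (m n : ℕ) (R : Fin d → H →L[ℂ] H) : H →L[ℂ] H :=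
  ∑ k ∈ Finset.range (n + 1), ((-1 : ℂ) ^ (n - k) * (n.choose k : ℂ)) •
    ((∑ i, adjointTuple R i) ^ k * isometricDefect m R * (∑ i, R i) ^ (n - k))

/-- A tuple is `(m, n)`-isosymmetric if it is commuting and `Λ_{m,n}(R) = 0`. -/
def IsIsosymmetric {d : ℕ} (m n : ℕ) (R : Fin d → H →L[ℂ] H) : Prop :=
  IsCommuting R ∧ isosymmetricDefect m n R = 0

end

/-- The Hilbert space tensor product: the completion of the algebraic tensor product with respect
to the inner product determined by `⟪a ⊗ b, c ⊗ d⟫ = ⟪a, c⟫ * ⟪b, d⟫`. -/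
abbrev HilbertTensor (E F : Type*) [NormedAddCommGroup E] [InnerProductSpace ℂ E]
    [NormedAddCommGroup F] [InnerProductSpace ℂ F] : Type _ :=
  UniformSpace.Completion (E ⊗[ℂ] F)

/-- The bounded operator `A ⊗ B` on the Hilbert space tensor product: the continuous extension of
`x ⊗ y ↦ A x ⊗ B y`. -/
noncomputable def opTensor {E F : Type*} [NormedAddCommGroup E] [InnerProductSpace ℂ E]
    [NormedAddCommGroup F] [InnerProductSpace ℂ F] (A : E →L[ℂ] E) (B : F →L[ℂ] F) :
    HilbertTensor E F →L[ℂ] HilbertTensor E F :=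
  (TensorProduct.mapL A B).completion

theorem opTensor_coe_tmul {E F : Type*} [NormedAddCommGroup E] [InnerProductSpace ℂ E]
    [NormedAddCommGroup F] [InnerProductSpace ℂ F] (A : E →L[ℂ] E) (B : F →L[ℂ] F)
    (x : E) (y : F) :
    opTensor A B ((x ⊗ₜ[ℂ] y : E ⊗[ℂ] F) : HilbertTensor E F) =
      ((A x ⊗ₜ[ℂ] B y : E ⊗[ℂ] F) : HilbertTensor E F) := by
  simp [opTensor]

end Multiop

open scoped Pointwise

universe u

open scoped IsMulCommutative in
theorem exists_commRing_algHom_of_pairwise_comm {A : Type u} [Ring A] [Algebra ℂ A] {s : Set A}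
    (hs : ∀ a ∈ s, ∀ b ∈ s, a * b = b * a) :
    ∃ (C : Type u) (_ : CommRing C) (_ : Algebra ℂ C) (ρ : C →ₐ[ℂ] A),
      Function.Injective ρ ∧ s ⊆ Set.range ρ := by
  have := Algebra.isMulCommutative_adjoin ℂ hs
  exact ⟨Algebra.adjoin ℂ s, inferInstance, inferInstance, (Algebra.adjoin ℂ s).val,
    Subtype.val_injective, fun a ha => ⟨⟨a, Algebra.subset_adjoin ha⟩, rfl⟩⟩

/-- If `p` is `q`-nilpotent, then so is the ideal generated by its entries. -/
theorem span_range_pow_eq_zero {C : Type*} [CommRing C] {d q : ℕ} {p : Fin d → C}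
    (hp : ∀ α : Fin d → ℕ, ∑ i, α i = q → ∏ i, p i ^ α i = 0) :
    Ideal.span (Set.range p) ^ q = 0 := by
  have h : Ideal.span (Set.range p) ^ q = Ideal.span (Set.range p ^ q) :=
    Submodule.span_pow (Set.range p) q
  rw [h, Ideal.zero_eq_bot, Ideal.span_eq_bot]
  intro a ha
  obtain ⟨f, rfl⟩ := Set.mem_pow.1 ha
  choose g hg using fun i => (f i).2
  rw [List.prod_ofFn]
  simp_rw [← hg]
  rw [← Finset.prod_fiberwise' Finset.univ g p]
  simp only [Finset.prod_const]
  refine hp _ ?_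
  simpa using Finset.sum_card_fiberwise_eq_card_filter Finset.univ Finset.univ g

theorem add_pow_mul_add_pow_mem {C : Type*} [CommRing C] {J : Ideal C} {m n N k : ℕ}
    (hJ : J ^ (k + 1) = 0) {x y u v : C} (hu : u ∈ J) (hv : v ∈ J) (hN : n + k ≤ N) :
    (y + v) ^ N * (x + u) ^ (m + k) ∈ Ideal.span {y ^ n * x ^ m} := by
  rw [add_pow, add_pow, Finset.sum_mul_sum]
  refine Ideal.sum_mem _ fun i hi => Ideal.sum_mem _ fun j hj => ?_
  rw [Ideal.mem_span_singleton]
  by_cases h : n ≤ i ∧ m ≤ j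
  · have h1 := pow_dvd_pow y h.1
    have h2 := pow_dvd_pow x h.2
    exact mul_dvd_mul ((h1.mul_right _).mul_right _) ((h2.mul_right _).mul_right _)
  · have h0 : v ^ (N - i) * u ^ (m + k - j) = 0 := by
      have : v ^ (N - i) * u ^ (m + k - j) ∈ J ^ ((N - i) + (m + k - j)) := by
        rw [pow_add]
        exact Ideal.mul_mem_mul (Ideal.pow_mem_pow hv _) (Ideal.pow_mem_pow hu _)
      have := Ideal.pow_le_pow_right (n := (N - i) + (m + k - j)) (m := k + 1)
        (by simp only [Finset.mem_range] at hi hj; omega) this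
      rwa [hJ] at this
    refine ⟨0, ?_⟩
    linear_combination (y ^ i * x ^ j * (N.choose i) * ((m + k).choose j)) * h0

namespace Multiop

section Bounded

variable {H : Type*} [NormedAddCommGroup H] [InnerProductSpace ℂ H] {d : ℕ}

theorem IsCommuting.reverse_prod {R : Fin d → H →L[ℂ] H} (hR : IsCommuting R) (γ : Fin d → ℕ) :
    (List.ofFn fun i => R i ^ γ i).reverse.prod = monomial R γ := by
  refine ((List.reverse_perm _).symm.prod_eq' ?_).symm
  rw [List.pairwise_ofFn]
  exact fun i j _ => Commute.pow_pow (hR i j) _ _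

theorem mulLeft_monomial (R : Fin d → H →L[ℂ] H) (γ : Fin d → ℕ) {C : Type*} [CommRing C]
    [Algebra ℂ C] (ρ : C →ₐ[ℂ] Module.End ℂ (H →L[ℂ] H)) {l : Fin d → C}
    (hl : ∀ i, ρ (l i) = LinearMap.mulLeft ℂ (R i)) :
    ρ (∏ i, l i ^ γ i) = LinearMap.mulLeft ℂ (monomial R γ) := by
  rw [← List.prod_ofFn, map_list_prod, monomial]
  change _ = Algebra.lmul ℂ _ _
  rw [map_list_prod, List.map_ofFn, List.map_ofFn]
  congr 2
  ext1 i
  simp only [Function.comp_apply, map_pow, hl]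
  rfl

theorem mulRight_list_prod {A : Type*} [Ring A] [Algebra ℂ A] (L : List A) :
    LinearMap.mulRight ℂ L.prod = (L.map (LinearMap.mulRight ℂ)).reverse.prod := by
  induction L with
  | nil => simp [Module.End.one_eq_id]
  | cons a L ih => simp [LinearMap.mulRight_mul, ih, Module.End.mul_eq_comp]

theorem mulRight_monomial (R : Fin d → H →L[ℂ] H) (γ : Fin d → ℕ) {C : Type*} [CommRing C]
    [Algebra ℂ C] (ρ : C →ₐ[ℂ] Module.End ℂ (H →L[ℂ] H)) {r : Fin d → C}
    (hr : ∀ i, ρ (r i) = LinearMap.mulRight ℂ (R i)) :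
    ρ (∏ i, r i ^ γ i) = LinearMap.mulRight ℂ (monomial R γ) := by
  rw [← List.prod_ofFn, ← List.prod_reverse, map_list_prod, monomial, mulRight_list_prod,
    List.map_reverse, List.map_ofFn, List.map_ofFn]
  congr 3
  ext1 i
  simp only [Function.comp_apply, map_pow, hr, LinearMap.pow_mulRight]

variable [CompleteSpace H]

theorem IsCommuting.adjointTuple {R : Fin d → H →L[ℂ] H} (hR : IsCommuting R) :
    IsCommuting (adjointTuple R) := fun i j => by
  simp only [Multiop.adjointTuple, ← ContinuousLinearMap.star_eq_adjoint, ← star_mul, hR i j]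

theorem IsCommuting.monomial_adjointTuple {R : Fin d → H →L[ℂ] H} (hR : IsCommuting R)
    (γ : Fin d → ℕ) :
    monomial (Multiop.adjointTuple R) γ = ContinuousLinearMap.adjoint (monomial R γ) := by
  rw [← hR.adjointTuple.reverse_prod, monomial, ← ContinuousLinearMap.star_eq_adjoint]
  have key : ∀ L : List (H →L[ℂ] H), star L.prod = (L.map star).reverse.prod := by
    intro L
    induction L with
    | nil => simp
    | cons a L ih => simp [ih]
  rw [key, List.map_ofFn]
  congr 3
  ext1 i
  simp [Multiop.adjointTuple, ContinuousLinearMap.star_eq_adjoint]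

theorem isometricDefect_eq (m : ℕ) (R : Fin d → H →L[ℂ] H) {C : Type*} [CommRing C]
    [Algebra ℂ C] (ρ : C →ₐ[ℂ] Module.End ℂ (H →L[ℂ] H)) {l r : Fin d → C}
    (hl : ∀ i, ρ (l i) = LinearMap.mulLeft ℂ (adjointTuple R i))
    (hr : ∀ i, ρ (r i) = LinearMap.mulRight ℂ (R i)) :
    isometricDefect m R = ρ ((∑ i, l i * r i - 1) ^ m) 1 := by
  have h : (∑ i, l i * r i - 1) ^ m = ∑ k ∈ Finset.range (m + 1),
      ((-1 : ℂ) ^ (m - k) * (m.choose k : ℂ)) •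
        ∑ γ ∈ Finset.piAntidiag (Finset.univ : Finset (Fin d)) k,
          (Nat.multinomial Finset.univ γ : ℂ) • ((∏ i, l i ^ γ i) * ∏ i, r i ^ γ i) := by
    rw [sub_eq_add_neg, add_pow]
    refine Finset.sum_congr rfl fun k _ => ?_
    rw [Finset.sum_pow_eq_sum_piAntidiag]
    simp only [mul_pow, Finset.prod_mul_distrib, Algebra.smul_def, map_mul, map_pow, map_neg,
      map_one, map_natCast]
    ring
  rw [h, isometricDefect]
  simp only [map_sum, map_smul, map_mul, LinearMap.sum_apply, LinearMap.smul_apply,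
    mulLeft_monomial _ _ ρ hl, mulRight_monomial _ _ ρ hr, Module.End.mul_apply,
    LinearMap.mulLeft_apply, LinearMap.mulRight_apply, one_mul]

theorem isosymmetricDefect_eq (m n : ℕ) (R : Fin d → H →L[ℂ] H) {C : Type*} [CommRing C]
    [Algebra ℂ C] (ρ : C →ₐ[ℂ] Module.End ℂ (H →L[ℂ] H)) {l r : Fin d → C}
    (hl : ∀ i, ρ (l i) = LinearMap.mulLeft ℂ (adjointTuple R i))
    (hr : ∀ i, ρ (r i) = LinearMap.mulRight ℂ (R i)) :
    isosymmetricDefect m n R =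
      ρ ((∑ i, l i - ∑ i, r i) ^ n * (∑ i, l i * r i - 1) ^ m) 1 := by
  have h : (∑ i, l i - ∑ i, r i) ^ n = ∑ k ∈ Finset.range (n + 1),
      ((-1 : ℂ) ^ (n - k) * (n.choose k : ℂ)) • ((∑ i, r i) ^ (n - k) * (∑ i, l i) ^ k) := by
    rw [sub_eq_add_neg, add_pow]
    refine Finset.sum_congr rfl fun k _ => ?_
    rw [neg_pow]
    simp only [Algebra.smul_def, map_mul, map_pow, map_neg, map_one, map_natCast]
    ring
  have hl' : ρ (∑ i, l i) = LinearMap.mulLeft ℂ (∑ i, adjointTuple R i) := by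
    ext1 T; simp [hl, LinearMap.sum_apply, Finset.sum_mul]
  have hr' : ρ (∑ i, r i) = LinearMap.mulRight ℂ (∑ i, R i) := by
    ext1 T; simp [hr, LinearMap.sum_apply, Finset.mul_sum]
  rw [map_mul, Module.End.mul_apply, ← isometricDefect_eq m R ρ hl hr, h, isosymmetricDefect]
  simp only [map_sum, map_smul, map_mul, map_pow, LinearMap.sum_apply, LinearMap.smul_apply, hl',
    hr', LinearMap.pow_mulLeft, LinearMap.pow_mulRight, Module.End.mul_apply,
    LinearMap.mulLeft_apply, LinearMap.mulRight_apply]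

theorem IsIsosymmetric.add_of_isNilpotentOfOrder {m n q : ℕ} (hq : 1 ≤ q) {R Q : Fin d → H →L[ℂ] H}
    (hR : IsIsosymmetric m n R) (hQ : IsNilpotentOfOrder q Q)
    (hRQ : ∀ i j, R i * Q j = Q j * R i) :
    IsIsosymmetric (m + 2 * q - 2) (n + 2 * q - 1) (fun i => R i + Q i) := by
  refine ⟨fun i j => ?_, ?_⟩
  · simp only [mul_add, add_mul, hR.1 i j, hQ.1 i j, hRQ i j, ← hRQ j i]
    abel
  have hRQ' : ∀ i j, adjointTuple R i * adjointTuple Q j = adjointTuple Q j * adjointTuple R i :=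
    fun i j => by
      simp only [adjointTuple, ← ContinuousLinearMap.star_eq_adjoint, ← star_mul, hRQ i j]
  let A : Fin d ⊕ Fin d → H →L[ℂ] H := Sum.elim (adjointTuple R) (adjointTuple Q)
  let B : Fin d ⊕ Fin d → H →L[ℂ] H := Sum.elim R Q
  have hA : ∀ i j, A i * A j = A j * A i := by
    rintro (i | i) (j | j)
    exacts [hR.1.adjointTuple i j, hRQ' i j, (hRQ' j i).symm, hQ.1.adjointTuple i j]
  have hB : ∀ i j, B i * B j = B j * B i := by
    rintro (i | i) (j | j)
    exacts [hR.1 i j, hRQ i j, (hRQ j i).symm, hQ.1 i j]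
  obtain ⟨C, _, _, ρ, hρ, hs⟩ := exists_commRing_algHom_of_pairwise_comm
    (s := Set.range (fun i => LinearMap.mulLeft ℂ (A i)) ∪
      Set.range (fun i => LinearMap.mulRight ℂ (B i))) (by
    rintro _ (⟨i, rfl⟩ | ⟨i, rfl⟩) _ (⟨j, rfl⟩ | ⟨j, rfl⟩) <;> ext1 T
    · simp only [Module.End.mul_apply, LinearMap.mulLeft_apply, ← mul_assoc, hA i j]
    · simp [mul_assoc]
    · simp [mul_assoc]
    · simp only [Module.End.mul_apply, LinearMap.mulRight_apply, mul_assoc, hB i j])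
  choose f hf using fun i => hs (Or.inl ⟨i, rfl⟩)
  choose g hg using fun i => hs (Or.inr ⟨i, rfl⟩)
  have hp : Ideal.span (Set.range fun i => f (.inr i)) ^ q = 0 :=
    span_range_pow_eq_zero fun α hα => hρ <| by
      rw [mulLeft_monomial (adjointTuple Q) α ρ fun i => hf (.inr i), hQ.1.monomial_adjointTuple,
        hQ.2 α hα]
      simp
  have hr : Ideal.span (Set.range fun i => g (.inr i)) ^ q = 0 :=
    span_range_pow_eq_zero fun α hα => hρ <| by
      rw [mulRight_monomial Q α ρ fun i => hg (.inr i), hQ.2 α hα]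
      simp
  set P := Ideal.span (Set.range fun i => f (.inr i))
  set P' := Ideal.span (Set.range fun i => g (.inr i))
  have hJ : (P + P') ^ (2 * q - 2 + 1) = 0 :=
    (Commute.all P P').add_pow_eq_zero_of_add_le_succ_of_pow_eq_zero hp hr (by omega)
  have hfJ : ∀ i, f (.inr i) ∈ P + P' := fun i =>
    Ideal.mem_sup_left (Ideal.subset_span ⟨i, rfl⟩)
  have hgJ : ∀ i, g (.inr i) ∈ P + P' := fun i =>
    Ideal.mem_sup_right (Ideal.subset_span ⟨i, rfl⟩)
  have hu : ∑ i, (f (.inl i) * g (.inr i) + f (.inr i) * (g (.inl i) + g (.inr i))) ∈ P + P' :=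
    Ideal.sum_mem _ fun i _ =>
      Ideal.add_mem _ (Ideal.mul_mem_left _ _ (hgJ i)) (Ideal.mul_mem_right _ _ (hfJ i))
  have hv : ∑ i, f (.inr i) - ∑ i, g (.inr i) ∈ P + P' :=
    Ideal.sub_mem _ (Ideal.sum_mem _ fun i _ => hfJ i) (Ideal.sum_mem _ fun i _ => hgJ i)
  have key := add_pow_mul_add_pow_mem (m := m) (n := n) (N := n + 2 * q - 1)
    (x := ∑ i, f (.inl i) * g (.inl i) - 1) (y := ∑ i, f (.inl i) - ∑ i, g (.inl i))
    hJ hu hv (by omega)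
  obtain ⟨c, hc⟩ := Ideal.mem_span_singleton'.1 key
  have h0 := hR.2
  rw [isosymmetricDefect_eq m n R ρ (fun i => hf (.inl i)) (fun i => hg (.inl i))] at h0
  rw [isosymmetricDefect_eq _ _ _ ρ (l := fun i => f (.inl i) + f (.inr i))
    (r := fun i => g (.inl i) + g (.inr i))]
  · have h1 : (∑ i, (f (.inl i) + f (.inr i)) - ∑ i, (g (.inl i) + g (.inr i))) =
        (∑ i, f (.inl i) - ∑ i, g (.inl i)) + (∑ i, f (.inr i) - ∑ i, g (.inr i)) := by
      simp only [Finset.sum_add_distrib]; ring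
    have h2 : ∑ i, (f (.inl i) + f (.inr i)) * (g (.inl i) + g (.inr i)) - 1 =
        (∑ i, f (.inl i) * g (.inl i) - 1) +
          ∑ i, (f (.inl i) * g (.inr i) + f (.inr i) * (g (.inl i) + g (.inr i))) := by
      rw [sub_add_eq_add_sub, ← Finset.sum_add_distrib]
      congr 1
      exact Finset.sum_congr rfl fun i _ => by ring
    rw [h1, h2, show m + 2 * q - 2 = m + (2 * q - 2) by omega, ← hc, map_mul,
      Module.End.mul_apply, h0, map_zero]
  · intro i
    rw [map_add, hf, hf]
    ext1 T
    simp [A, adjointTuple, add_mul]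
  · intro i
    rw [map_add, hg, hg]
    ext1 T
    simp [B, mul_add]

end Bounded

section Tensor

variable {E F : Type*} [NormedAddCommGroup E] [InnerProductSpace ℂ E]
  [NormedAddCommGroup F] [InnerProductSpace ℂ F]

theorem ext_tmul {S T : HilbertTensor E F →L[ℂ] HilbertTensor E F}
    (h : ∀ x y, S ((x ⊗ₜ[ℂ] y : E ⊗[ℂ] F) : HilbertTensor E F) =
      T ((x ⊗ₜ[ℂ] y : E ⊗[ℂ] F) : HilbertTensor E F)) : S = T := by
  ext1 z
  induction z using UniformSpace.Completion.induction_on with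
  | hp => exact isClosed_eq S.continuous T.continuous
  | ih z =>
    induction z using TensorProduct.induction_on with
    | zero => rw [UniformSpace.Completion.coe_zero, map_zero, map_zero]
    | tmul x y => exact h x y
    | add a b ha hb => rw [UniformSpace.Completion.coe_add, map_add, map_add, ha, hb]

theorem opTensor_mul (A A' : E →L[ℂ] E) (B B' : F →L[ℂ] F) :
    opTensor A B * opTensor A' B' = opTensor (A * A') (B * B') :=
  ext_tmul fun x y => by simp [opTensor_coe_tmul]

/-- The algebra homomorphism `A ↦ A ⊗ I`. -/
noncomputable def opTensorLeft (E F : Type*) [NormedAddCommGroup E] [InnerProductSpace ℂ E]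
    [NormedAddCommGroup F] [InnerProductSpace ℂ F] :
    (E →L[ℂ] E) →ₐ[ℂ] (HilbertTensor E F →L[ℂ] HilbertTensor E F) :=
  AlgHom.ofLinearMap
    { toFun := fun A => opTensor A 1
      map_add' := fun A B => ext_tmul fun x y => by
        simp [opTensor_coe_tmul, TensorProduct.add_tmul, UniformSpace.Completion.coe_add]
      map_smul' := fun c A => ext_tmul fun x y => by
        simp [opTensor_coe_tmul, ← TensorProduct.smul_tmul', UniformSpace.Completion.coe_smul] }
    (ext_tmul fun x y => by simp [opTensor_coe_tmul])
    (fun A B => by simp [opTensor_mul])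

/-- The algebra homomorphism `B ↦ I ⊗ B`. -/
noncomputable def opTensorRight (E F : Type*) [NormedAddCommGroup E] [InnerProductSpace ℂ E]
    [NormedAddCommGroup F] [InnerProductSpace ℂ F] :
    (F →L[ℂ] F) →ₐ[ℂ] (HilbertTensor E F →L[ℂ] HilbertTensor E F) :=
  AlgHom.ofLinearMap
    { toFun := fun B => opTensor 1 B
      map_add' := fun A B => ext_tmul fun x y => by
        simp [opTensor_coe_tmul, TensorProduct.tmul_add, UniformSpace.Completion.coe_add]
      map_smul' := fun c A => ext_tmul fun x y => by
        simp [opTensor_coe_tmul, UniformSpace.Completion.coe_smul] }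
    (ext_tmul fun x y => by simp [opTensor_coe_tmul])
    (fun A B => by simp [opTensor_mul])

theorem adjoint_opTensor [CompleteSpace E] [CompleteSpace F] (A : E →L[ℂ] E) (B : F →L[ℂ] F) :
    ContinuousLinearMap.adjoint (opTensor A B) =
      opTensor (ContinuousLinearMap.adjoint A) (ContinuousLinearMap.adjoint B) := by
  symm
  rw [ContinuousLinearMap.eq_adjoint_iff]
  intro z w
  induction z, w using UniformSpace.Completion.induction_on₂ with
  | hp => exact isClosed_eq (by fun_prop) (by fun_prop)
  | ih z w =>
    induction z using TensorProduct.induction_on with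
    | zero => simp only [UniformSpace.Completion.coe_zero, map_zero, inner_zero_left]
    | add a b ha hb => simp only [UniformSpace.Completion.coe_add, map_add, inner_add_left, ha, hb]
    | tmul x y =>
      induction w using TensorProduct.induction_on with
      | zero => simp only [UniformSpace.Completion.coe_zero, map_zero, inner_zero_right]
      | add a b ha hb =>
        simp only [UniformSpace.Completion.coe_add, map_add, inner_add_right, ha, hb]
      | tmul x' y' =>
        simp [opTensor_coe_tmul, UniformSpace.Completion.inner_coe,
          ContinuousLinearMap.adjoint_inner_left]

end Tensor

section Map

variable {E K : Type*} [NormedAddCommGroup E] [InnerProductSpace ℂ E]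
  [NormedAddCommGroup K] [InnerProductSpace ℂ K] {d : ℕ}
  (φ : (E →L[ℂ] E) →ₐ[ℂ] (K →L[ℂ] K))

theorem monomial_map (R : Fin d → E →L[ℂ] E) (γ : Fin d → ℕ) :
    monomial (fun i => φ (R i)) γ = φ (monomial R γ) := by
  simp only [monomial, map_list_prod, List.map_ofFn, Function.comp_def, map_pow]

theorem IsCommuting.map {R : Fin d → E →L[ℂ] E} (hR : IsCommuting R) :
    IsCommuting fun i => φ (R i) := fun i j => by rw [← map_mul, hR i j, map_mul]

theorem IsNilpotentOfOrder.map {q : ℕ} {Q : Fin d → E →L[ℂ] E} (hQ : IsNilpotentOfOrder q Q) :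
    IsNilpotentOfOrder q fun i => φ (Q i) :=
  ⟨hQ.1.map φ, fun α hα => by rw [monomial_map, hQ.2 α hα, map_zero]⟩

theorem IsIsosymmetric.map [CompleteSpace E] [CompleteSpace K] {m n : ℕ} {R : Fin d → E →L[ℂ] E}
    (hφ : ∀ T, ContinuousLinearMap.adjoint (φ T) = φ (ContinuousLinearMap.adjoint T))
    (hR : IsIsosymmetric m n R) : IsIsosymmetric m n fun i => φ (R i) := by
  refine ⟨hR.1.map φ, ?_⟩
  have hadj : adjointTuple (fun i => φ (R i)) = fun i => φ (adjointTuple R i) :=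
    funext fun i => hφ (R i)
  rw [← map_zero φ, ← hR.2]
  simp only [isosymmetricDefect, isometricDefect, hadj, monomial_map, map_sum, map_smul, map_mul,
    map_pow]

end Map

end Multiop

theorem mainTheorem8 {H : Type*} [NormedAddCommGroup H] [InnerProductSpace ℂ H] [CompleteSpace H]
    (d m n q : ℕ) (hq : 1 ≤ q) (R Q : Fin d → H →L[ℂ] H)
    (hR : Multiop.IsIsosymmetric m n R) (hQ : Multiop.IsNilpotentOfOrder q Q) :
    Multiop.IsIsosymmetric (m + 2 * q - 2) (n + 2 * q - 1)
      (fun k : Fin d => Multiop.opTensor (R k) (1 : H →L[ℂ] H) +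
        Multiop.opTensor (1 : H →L[ℂ] H) (Q k)) := by
  have hR' := hR.map (Multiop.opTensorLeft H H) fun T =>
    (Multiop.adjoint_opTensor T 1).trans (by
      rw [← ContinuousLinearMap.star_eq_adjoint (1 : H →L[ℂ] H), star_one]; rfl)
  refine hR'.add_of_isNilpotentOfOrder hq (hQ.map (Multiop.opTensorRight H H)) fun i j => ?_
  change Multiop.opTensor _ _ * Multiop.opTensor _ _ = Multiop.opTensor _ _ * Multiop.opTensor _ _
  simp only [Multiop.opTensor_mul, mul_one, one_mul]
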